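/- Let $n,T$ be non-negative integers, $K\in\mathbb{R}^{n\times n}$ symmetric positive semidefinite, $Y\in\mathbb{R}^{n\times T}$, $\lambda>0$ and $\delta>0$. Let $V(Y,\cdot):\mathbb{R}^{n\times T}\to[0,\infty)$ be convex, and let $F:S_+^T\to[0,\infty)$ be convex and coercive ($F(A)\to+\infty$ as $\|A\|\to\infty$), where $S_+^T$ is the cone of symmetric positive semidefinite $T\times T$ matrices and $S_{++}^T$ the set of positive definite ones. Consider the problem $$(S^\delta)\qquad \min_{C\in\mathbb{R}^{n\times T},\ A\in S_+^T}\ S(C,A),\qquad S(C,A)=V(Y,KC)+\lambda\,\mathrm{tr}\big(A^{-1}(C^\top KC+\delta^2 I_T)\big)+F(A)\ \text{ if } A\in S_{++}^T,$$ with $S(C,A)=+\infty$ if $A\in S_+^T\setminus S_{++}^T$. Starting from some $C_0\in\mathbb{R}^{n\times T}$, $A_0\in S_+^T$, a block coordinate algorithm generates, without stopping, an infinite sequence $(C_t,A_t)_{t\ge0}$ as follows: $C_{t+1}$ is an output of a procedure SupervisedStep applied to the function $C\mapsto S(C,A_t)$ on $\mathbb{R}^{n\times T}$ at the current point $C_t$;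 then $A_{t+1}$ is an output of a procedure UnsupervisedStep applied to the function $A\mapsto S(C_{t+1},A)$ on $S_+^T$ at the current point $A_t$. A *first-order step* with step size $\gamma>0$ for an extended-real function $f$ on a set $X$ of matrices, from $x$ to $x'$, is the following. Let $U=\{y\in X: f(y)<+\infty\}$. There are a convex set $D$ with $U\subseteq D\subseteq X$, a convex $g:U\to\mathbb{R}$ differentiable at $x$ (relative to $U$) and a convex $h:D\to\mathbb{R}$ with $f=g+h$ on $U$, such that $x,x'\in U$, $$x'\in\operatorname*{argmin}_{y\in D}\ \Big\{h(y)+\langle\nabla g(x),y-x\rangle+\tfrac1{2\gamma}\|y-x\|_F^2\Big\},$$ and the step size is admissible in the sense that $g(x')\le g(x)+\langle\nabla g(x),x'-x\rangle+\frac1{2\gamma}\|x'-x\|_F^2$ (this is automatic if $\nabla g$ is $L$-Lipschitz on $U$ and $\gamma\le1/L$, and can otherwise be enforced by backtracking). The functions $g,h$, the set $D$ and $\gamma$ may change from step to step. This contains gradient descent and projected gradient descent ($h=0$, $D=X$), the proximal gradient method ($D=X$) and the proximal point method ($g=0$, $h=f$, $D=U$). Then the following hold. (a) Alternating minimization. If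 every $C_{t+1}$ is a minimizer of $S(\cdot,A_t)$ over $\mathbb{R}^{n\times T}$ and every $A_{t+1}$ is a minimizer of $S(C_{t+1},\cdot)$ over $S_+^T$, then every limit point of $(C_t,A_t)_t$ is a global minimizer of $(S^\delta)$. (b) Block coordinate descent. If every $C_{t+1}$ is obtained from $C_t$ by a single first-order step for $S(\cdot,A_t)$ on $\mathbb{R}^{n\times T}$, every $A_{t+1}$ is obtained from $A_t$ by a single first-order step for $S(C_{t+1},\cdot)$ on $S_+^T$, and all step sizes are at least some $\gamma_{\min}>0$, then every limit point of $(C_t,A_t)_t$ is a global minimizer of $(S^\delta)$. -/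

import Mathlib

open Filter Topology

/-- The objective `V(Y, K C) + lam * tr(A⁻¹ (Cᵀ K C + δ² I)) + F(A)` of the perturbed problem.
It is finite exactly when `A` is positive definite; on the boundary of the cone of positive
semidefinite matrices the barrier makes it `+∞`. -/
noncomputable def perturbedObjective {n T : ℕ}
    (V : Matrix (Fin n) (Fin T) ℝ → Matrix (Fin n) (Fin T) ℝ → ℝ)
    (F : Matrix (Fin T) (Fin T) ℝ → ℝ)
    (K : Matrix (Fin n) (Fin n) ℝ) (Y : Matrix (Fin n) (Fin T) ℝ) (lam δ : ℝ)
    (C : Matrix (Fin n) (Fin T) ℝ) (A : Matrix (Fin T) (Fin T) ℝ) : EReal :=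
  open Classical in
  if A.PosDef then
    ((V Y (K * C)
      + lam * (A⁻¹ * (C.transpose * K * C + δ ^ 2 • (1 : Matrix (Fin T) (Fin T) ℝ))).trace
      + F A : ℝ) : EReal)
  else ⊤

/-- The cone of real symmetric positive semidefinite matrices. -/
def psdCone (T : ℕ) : Set (Matrix (Fin T) (Fin T) ℝ) := {A | A.PosSemidef}

/-- `F` is coercive on the positive semidefinite cone: `F A → +∞` as `‖A‖ → ∞` in the cone. -/
def CoerciveOnPSD {T : ℕ} (F : Matrix (Fin T) (Fin T) ℝ → ℝ) : Prop :=
  Tendsto F (cocompact (Matrix (Fin T) (Fin T) ℝ) ⊓ 𝓟 (psdCone T)) atTop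

/-- `x` is a minimizer of the extended-real function `f` over the set `X`. -/
def IsMinimizer {E : Type*} (f : E → EReal) (X : Set E) (x : E) : Prop :=
  x ∈ X ∧ ∀ y ∈ X, f x ≤ f y

/-- The squared Frobenius norm. -/
def frobSq {p q : ℕ} (M : Matrix (Fin p) (Fin q) ℝ) : ℝ := ∑ i, ∑ j, M i j ^ 2

/-- `x'` is obtained from `x` by a single step, with some step size `γ ≥ γmin`, of a first order
(forward-backward) method for minimizing `f` over `X`.

On its effective domain `U` the function `f` is split as `g + h`, with `g` convex and
differentiable at `x` (derivative `g'`, so `g' v = ⟪∇g(x), v⟫`) and `h` convex on a convex set `D`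
between `U` and `X`. The point `x'` minimizes `h(y) + g'(y - x) + ‖y - x‖² / (2γ)` over `y ∈ D`,
that is, `x'` is the proximal point of `γ h` (on `D`) at `x - γ ∇g(x)`. The step size is
admissible: `x'` lies in the effective domain, and the quadratic upper bound for `g` holds at `x'`
(as for step sizes at most `1/L` when `∇g` is `L`-Lipschitz, or for backtracking).

* `h = 0`, `D = X`: projected gradient descent (gradient descent if `X` is the whole space);
* `D = X`, `g` the smooth part of `f`: the proximal gradient method;
* `g = 0`, `h = f`, `D = U`: the proximal point method. -/
def IsFirstOrderStep {p q : ℕ} (γmin : ℝ) (f : Matrix (Fin p) (Fin q) ℝ → EReal)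
    (X : Set (Matrix (Fin p) (Fin q) ℝ)) (x x' : Matrix (Fin p) (Fin q) ℝ) : Prop :=
  ∃ (γ : ℝ) (U D : Set (Matrix (Fin p) (Fin q) ℝ)) (g h : Matrix (Fin p) (Fin q) ℝ → ℝ)
    (g' : Matrix (Fin p) (Fin q) ℝ →L[ℝ] ℝ),
    γmin ≤ γ ∧
    U = {y | y ∈ X ∧ f y < ⊤} ∧ U ⊆ D ∧ D ⊆ X ∧
    ConvexOn ℝ U g ∧ ConvexOn ℝ D h ∧
    (∀ y ∈ U, f y = ((g y + h y : ℝ) : EReal)) ∧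
    x ∈ U ∧ HasFDerivWithinAt g g' U x ∧
    x' ∈ U ∧
    (∀ y ∈ D, h x' + g' (x' - x) + frobSq (x' - x) / (2 * γ)
      ≤ h y + g' (y - x) + frobSq (y - x) / (2 * γ)) ∧
    g x' ≤ g x + g' (x' - x) + frobSq (x' - x) / (2 * γ)

/-- The pair of sequences `(C t, A t)` is generated by the two-block algorithm that alternates
`C (t+1) ← SupervisedStep (C t) (A t)` and `A (t+1) ← UnsupervisedStep (C (t+1)) (A t)`, started
from a feasible point and run without stopping. The two procedures are relations: the last
argument is an admissible output for the first two. -/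
def IsBlockRun {n T : ℕ}
    (supervisedStep : Matrix (Fin n) (Fin T) ℝ → Matrix (Fin T) (Fin T) ℝ →
      Matrix (Fin n) (Fin T) ℝ → Prop)
    (unsupervisedStep : Matrix (Fin n) (Fin T) ℝ → Matrix (Fin T) (Fin T) ℝ →
      Matrix (Fin T) (Fin T) ℝ → Prop)
    (C : ℕ → Matrix (Fin n) (Fin T) ℝ) (A : ℕ → Matrix (Fin T) (Fin T) ℝ) : Prop :=
  A 0 ∈ psdCone T ∧
  ∀ t, supervisedStep (C t) (A t) (C (t + 1)) ∧ unsupervisedStep (C (t + 1)) (A t) (A (t + 1))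

/-- A run of alternating minimization for `S`: both procedures return an exact minimizer of `S`
in their block, the other block being held fixed. -/
def IsAlternatingMinimizationRun {n T : ℕ}
    (S : Matrix (Fin n) (Fin T) ℝ → Matrix (Fin T) (Fin T) ℝ → EReal)
    (C : ℕ → Matrix (Fin n) (Fin T) ℝ) (A : ℕ → Matrix (Fin T) (Fin T) ℝ) : Prop :=
  IsBlockRun
    (fun _ A₀ C₁ => IsMinimizer (fun C' => S C' A₀) Set.univ C₁)
    (fun C₁ _ A₁ => IsMinimizer (fun A' => S C₁ A') (psdCone T) A₁) C A

/-- A run of block coordinate descent for `S`: both procedures perform a single first order step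
in their block, the other block being held fixed, with step sizes at least `γmin`. -/
def IsBlockCoordinateDescentRun {n T : ℕ} (γmin : ℝ)
    (S : Matrix (Fin n) (Fin T) ℝ → Matrix (Fin T) (Fin T) ℝ → EReal)
    (C : ℕ → Matrix (Fin n) (Fin T) ℝ) (A : ℕ → Matrix (Fin T) (Fin T) ℝ) : Prop :=
  IsBlockRun
    (fun C₀ A₀ C₁ => IsFirstOrderStep γmin (fun C' => S C' A₀) Set.univ C₀ C₁)
    (fun C₁ A₀ A₁ => IsFirstOrderStep γmin (fun A' => S C₁ A') (psdCone T) A₀ A₁) C A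

/-! On positive definite `A`, `tr (A⁻¹ Cᵀ K C)` is a supremum of affine functions of `(C, A)`, so
the barrier is jointly convex and also differentiable. The possibly nonsmooth terms `V` and `F` each
involve one block only. Hence the first-order conditions of the two blocks add up to a global one
(`finiteObjective_le_of_blockwise`), and it suffices that limit points are blockwise minimal.

Exact minimization and a first-order step both satisfy `IsDescentStep`: the new value is at most the
value at any competitor, plus `ε` times a squared distance, plus the achieved decrease divided by
`ε`. The objective decreases and is bounded below, so the decreases tend to zero. Passing to the
limit along the iterates and then letting `ε → 0` gives blockwise minimality
(`isMinimizer_of_isDescentStep`). The term `δ² tr A⁻¹` stays bounded along the run, so the limit of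
the `A` block is positive definite and the objective is continuous there. -/

/-! ### Trace inequalities -/

open scoped MatrixOrder in
/-- The trace of the product of two positive semidefinite matrices is nonnegative. -/
theorem Matrix.PosSemidef.trace_mul_nonneg {m : Type*} [Fintype m] [DecidableEq m]
    {A B : Matrix m m ℝ} (hA : A.PosSemidef) (hB : B.PosSemidef) : 0 ≤ (A * B).trace := by
  obtain ⟨R, rfl⟩ := CStarAlgebra.nonneg_iff_eq_star_mul_self.mp hA.nonneg
  rw [Matrix.star_eq_conjTranspose, Matrix.mul_assoc, Matrix.trace_mul_comm]
  exact (hB.mul_mul_conjTranspose_same R).trace_nonneg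

/-- The quadratic-over-linear function `tr (A⁻¹ Cᵀ K C)` lies above its tangents. -/
theorem Matrix.PosDef.tangent_le_trace_inv_mul {m k : Type*} [Fintype m] [DecidableEq m] [Fintype k]
    {K : Matrix k k ℝ} (hK : K.PosSemidef) {A : Matrix m m ℝ} (hA : A.PosDef) (C W : Matrix k m ℝ) :
    2 * (W.transpose * K * C).trace - (W.transpose * K * W * A).trace
      ≤ (A⁻¹ * (C.transpose * K * C)).trace := by
  have hdet : IsUnit A.det := A.isUnit_iff_isUnit_det.mp hA.isUnit
  have hAt : A.transpose = A := by simpa using hA.isHermitian.eq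
  have hKt : K.transpose = K := by simpa using hK.isHermitian.eq
  -- Completing the square: expanding this nonnegative trace gives the claim, with equality at `W =
  -- C * A⁻¹`.
  have h0 : 0 ≤ (A⁻¹ * ((C - W * A).transpose * K * (C - W * A))).trace :=
    hA.inv.posSemidef.trace_mul_nonneg (by simpa using hK.conjTranspose_mul_mul_same (C - W * A))
  have e1 : (A⁻¹ * (C.transpose * K * (W * A))).trace = (W.transpose * K * C).trace := by
    rw [Matrix.trace_mul_comm, ← Matrix.mul_assoc, Matrix.mul_assoc _ A, Matrix.mul_nonsing_inv _ hdet,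
      Matrix.mul_one, ← Matrix.trace_transpose]
    simp [Matrix.transpose_mul, hKt, Matrix.mul_assoc]
  have e2 : (A⁻¹ * ((W * A).transpose * K * C)).trace = (W.transpose * K * C).trace := by
    rw [Matrix.transpose_mul, hAt]
    simp only [← Matrix.mul_assoc]
    rw [Matrix.nonsing_inv_mul _ hdet, Matrix.one_mul]
  have e3 : (A⁻¹ * ((W * A).transpose * K * (W * A))).trace = (W.transpose * K * W * A).trace := by
    rw [Matrix.transpose_mul, hAt]
    simp only [← Matrix.mul_assoc]
    rw [Matrix.nonsing_inv_mul _ hdet, Matrix.one_mul]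
  have : (A⁻¹ * ((C - W * A).transpose * K * (C - W * A))).trace
      = (A⁻¹ * (C.transpose * K * C)).trace - (A⁻¹ * (C.transpose * K * (W * A))).trace
        - ((A⁻¹ * ((W * A).transpose * K * C)).trace
          - (A⁻¹ * ((W * A).transpose * K * (W * A))).trace) := by
    simp only [Matrix.transpose_sub, Matrix.sub_mul, Matrix.mul_sub, Matrix.trace_sub]
    ring
  linarith

/-- The choice `W = C₀ * A₀⁻¹` makes the affine minorant touch at `(C₀, A₀)`. This is joint
convexity in gradient form, obtained without differentiating the inverse. -/
theorem Matrix.PosDef.trace_inv_mul_tangent {m k : Type*} [Fintype m] [DecidableEq m] [Fintype k]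
    {K : Matrix k k ℝ} (hK : K.PosSemidef) {A A₀ : Matrix m m ℝ} (hA : A.PosDef) (hA₀ : A₀.PosDef)
    (C C₀ : Matrix k m ℝ) :
    (A₀⁻¹ * (C₀.transpose * K * C₀)).trace + 2 * (A₀⁻¹ * (C₀.transpose * K * (C - C₀))).trace
      - (A₀⁻¹ * (C₀.transpose * K * C₀) * A₀⁻¹ * (A - A₀)).trace
      ≤ (A⁻¹ * (C.transpose * K * C)).trace := by
  have hdet : IsUnit A₀.det := A₀.isUnit_iff_isUnit_det.mp hA₀.isUnit
  have hAt : A₀⁻¹.transpose = A₀⁻¹ := by simpa using hA₀.inv.isHermitian.eq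
  have h := hA.tangent_le_trace_inv_mul hK C (C₀ * A₀⁻¹)
  have e : (A₀⁻¹ * (C₀.transpose * K * C₀) * A₀⁻¹ * A₀).trace
      = (A₀⁻¹ * (C₀.transpose * K * C₀)).trace := by
    rw [Matrix.mul_assoc _ A₀⁻¹, Matrix.nonsing_inv_mul _ hdet, Matrix.mul_one]
  rw [Matrix.transpose_mul, hAt] at h
  simp only [Matrix.mul_sub, Matrix.trace_sub, e]
  simp only [Matrix.mul_assoc] at h ⊢
  linarith

/-! ### The barrier term -/

/-- The barrier `tr (A⁻¹ (Cᵀ K C + δ² I))`. -/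
noncomputable def traceBarrier {n T : ℕ} (K : Matrix (Fin n) (Fin n) ℝ) (δ : ℝ)
    (C : Matrix (Fin n) (Fin T) ℝ) (A : Matrix (Fin T) (Fin T) ℝ) : ℝ :=
  (A⁻¹ * (C.transpose * K * C + δ ^ 2 • (1 : Matrix (Fin T) (Fin T) ℝ))).trace

section barrier

variable {n T : ℕ} {K : Matrix (Fin n) (Fin n) ℝ} {δ : ℝ}

/-- The term `δ² tr A⁻¹` is the same quadratic-over-linear function with `K`, `C` and `C₀` all equal
to the identity, so two tangent inequalities are added. -/
theorem traceBarrier_tangent (hK : K.PosSemidef) {A A₀ : Matrix (Fin T) (Fin T) ℝ}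
    (hA : A.PosDef) (hA₀ : A₀.PosDef) (C C₀ : Matrix (Fin n) (Fin T) ℝ) :
    traceBarrier K δ C₀ A₀ + 2 * (A₀⁻¹ * (C₀.transpose * K * (C - C₀))).trace
      - (A₀⁻¹ * (C₀.transpose * K * C₀ + δ ^ 2 • (1 : Matrix (Fin T) (Fin T) ℝ)) * A₀⁻¹
          * (A - A₀)).trace
      ≤ traceBarrier K δ C A := by
  have h1 := hA.trace_inv_mul_tangent hK hA₀ C C₀
  have h2 := mul_le_mul_of_nonneg_left
    (hA.trace_inv_mul_tangent (Matrix.PosSemidef.one (n := Fin T) (R := ℝ)) hA₀ 1 1) (sq_nonneg δ)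
  simp only [traceBarrier, Matrix.mul_add, Matrix.add_mul, Matrix.trace_add, Matrix.mul_smul,
    Matrix.smul_mul, Matrix.trace_smul, smul_eq_mul]
  simp only [Matrix.transpose_one, Matrix.mul_one, sub_self, Matrix.trace_zero,
    mul_zero, add_zero] at h2 ⊢
  linarith

theorem traceBarrier_nonneg (hK : K.PosSemidef) {A : Matrix (Fin T) (Fin T) ℝ}
    (hA : A.PosDef) (C : Matrix (Fin n) (Fin T) ℝ) : 0 ≤ traceBarrier K δ C A := by
  refine hA.inv.posSemidef.trace_mul_nonneg (Matrix.PosSemidef.add ?_ ?_)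
  · simpa using hK.conjTranspose_mul_mul_same C
  · exact Matrix.PosSemidef.one.smul (sq_nonneg δ)

theorem sq_mul_trace_inv_le_traceBarrier (hK : K.PosSemidef) {A : Matrix (Fin T) (Fin T) ℝ}
    (hA : A.PosDef) (C : Matrix (Fin n) (Fin T) ℝ) :
    δ ^ 2 * A⁻¹.trace ≤ traceBarrier K δ C A := by
  have h : 0 ≤ (A⁻¹ * (C.transpose * K * C)).trace := hA.inv.posSemidef.trace_mul_nonneg
    (by simpa using hK.conjTranspose_mul_mul_same C)
  simp only [traceBarrier, Matrix.mul_add, Matrix.trace_add, Matrix.mul_smul, Matrix.mul_one,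
    Matrix.trace_smul, smul_eq_mul]
  linarith

/-- The coefficient of `s` is the `C`-part of the tangent in `traceBarrier_tangent`; this match lets
the blockwise conditions cancel the tangent terms. -/
theorem traceBarrier_add_smul (hK : K.PosSemidef) {A : Matrix (Fin T) (Fin T) ℝ}
    (hA : A.PosDef) (C E : Matrix (Fin n) (Fin T) ℝ) (s : ℝ) :
    traceBarrier K δ (C + s • E) A = traceBarrier K δ C A
      + s * (2 * (A⁻¹ * (C.transpose * K * E)).trace)
      + s ^ 2 * (A⁻¹ * (E.transpose * K * E)).trace := by
  have hAt : A⁻¹.transpose = A⁻¹ := by simpa using hA.inv.isHermitian.eq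
  have hKt : K.transpose = K := by simpa using hK.isHermitian.eq
  have e : (A⁻¹ * (E.transpose * K * C)).trace = (A⁻¹ * (C.transpose * K * E)).trace := by
    rw [← Matrix.trace_transpose, Matrix.transpose_mul, hAt, Matrix.trace_mul_comm]
    simp [Matrix.transpose_mul, hKt, Matrix.mul_assoc]
  simp only [traceBarrier, Matrix.transpose_add, Matrix.transpose_smul, Matrix.mul_add,
    Matrix.add_mul, Matrix.trace_add, Matrix.mul_smul, Matrix.smul_mul, Matrix.trace_smul,
    smul_eq_mul, e]
  ring

theorem Matrix.PosDef.continuousAt_inv {m : Type*} [Fintype m] [DecidableEq m] {A : Matrix m m ℝ}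
    (hA : A.PosDef) : ContinuousAt (fun B : Matrix m m ℝ => B⁻¹) A := by
  refine continuousAt_matrix_inv A ?_
  have hdet : A.det ≠ 0 := (A.isUnit_iff_isUnit_det.mp hA.isUnit).ne_zero
  rw [Ring.inverse_eq_inv']
  exact continuousAt_inv₀ hdet

theorem tendsto_traceBarrier {ι : Type*} {l : Filter ι} {c : ι → Matrix (Fin n) (Fin T) ℝ}
    {a : ι → Matrix (Fin T) (Fin T) ℝ} {C : Matrix (Fin n) (Fin T) ℝ}
    {A : Matrix (Fin T) (Fin T) ℝ} (hA : A.PosDef)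
    (hc : Tendsto c l (𝓝 C)) (ha : Tendsto a l (𝓝 A)) :
    Tendsto (fun i => traceBarrier K δ (c i) (a i)) l (𝓝 (traceBarrier K δ C A)) := by
  have hinv : Tendsto (fun i => (a i)⁻¹) l (𝓝 A⁻¹) := hA.continuousAt_inv.tendsto.comp ha
  have hq : Continuous fun B : Matrix (Fin n) (Fin T) ℝ =>
      B.transpose * K * B + δ ^ 2 • (1 : Matrix (Fin T) (Fin T) ℝ) :=
    ((continuous_id.matrix_transpose.matrix_mul continuous_const).matrix_mul continuous_id).add
      continuous_const
  have htr : Continuous fun B : Matrix (Fin T) (Fin T) ℝ => B.trace :=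
    continuous_id.matrix_trace
  have h : Tendsto (fun i => (a i)⁻¹ * ((c i).transpose * K * c i + δ ^ 2 • 1)) l
      (𝓝 (A⁻¹ * (C.transpose * K * C + δ ^ 2 • 1))) :=
    hinv.mul ((hq.tendsto C).comp hc)
  exact (htr.tendsto _).comp h

end barrier

/-! ### Limits of positive definite matrices and continuity of convex functions -/

/-- A limit of positive definite matrices whose inverses have bounded trace is positive definite. -/
theorem Matrix.PosDef.of_tendsto_of_trace_inv_le {T : ℕ} {ι : Type*} {l : Filter ι} [l.NeBot]
    {a : ι → Matrix (Fin T) (Fin T) ℝ} {A : Matrix (Fin T) (Fin T) ℝ} {M : ℝ}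
    (ha : Tendsto a l (𝓝 A)) (hpd : ∀ᶠ i in l, (a i).PosDef)
    (hM : ∀ᶠ i in l, (a i)⁻¹.trace ≤ M) : A.PosDef := by
  have hherm : A.IsHermitian := by
    have h1 : Tendsto (fun i => (a i).conjTranspose) l (𝓝 A.conjTranspose) :=
      ((continuous_id.matrix_conjTranspose).tendsto A).comp ha
    exact tendsto_nhds_unique (h1.congr' (hpd.mono fun i hi => hi.isHermitian.eq)) ha
  have hquad : ∀ x : Fin T → ℝ, Tendsto (fun i => x ⬝ᵥ (a i).mulVec x) l (𝓝 (x ⬝ᵥ A.mulVec x)) := by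
    intro x
    have : Continuous fun B : Matrix (Fin T) (Fin T) ℝ => x ⬝ᵥ B.mulVec x := by fun_prop
    exact (this.tendsto A).comp ha
  -- The tangent bound with `W = s x xᵀ` survives the limit without inverting `A`. If `xᵀ A x = 0`,
  -- its left side is linear in `s` and cannot stay below `M`.
  have hkey : ∀ (x : Fin T → ℝ) (s : ℝ),
      2 * (s * (x ⬝ᵥ x)) - s ^ 2 * (x ⬝ᵥ x) * (x ⬝ᵥ A.mulVec x) ≤ M := by
    intro x s
    refine le_of_tendsto (((hquad x).const_mul (s ^ 2 * (x ⬝ᵥ x))).const_sub _) ?_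
    filter_upwards [hpd, hM] with i hi hMi
    refine le_trans ?_ hMi
    have h := hi.tangent_le_trace_inv_mul (Matrix.PosSemidef.one (n := Fin T) (R := ℝ)) 1
      (s • Matrix.vecMulVec x x)
    simp only [Matrix.transpose_smul, Matrix.transpose_vecMulVec, Matrix.mul_one, Matrix.smul_mul,
      Matrix.mul_smul, Matrix.trace_smul, smul_eq_mul, Matrix.transpose_one,
      Matrix.vecMulVec_mul, Matrix.vecMul_vecMulVec, Matrix.smul_vecMul, dotProduct_smul, Matrix.trace_vecMulVec,
      smul_smul] at h
    refine le_trans (le_of_eq ?_) h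
    rw [Matrix.dotProduct_mulVec, dotProduct_comm (Matrix.vecMul x (a i)) x]
    ring
  refine Matrix.PosDef.of_dotProduct_mulVec_pos hherm fun x hx => ?_
  have hxx : 0 < x ⬝ᵥ x := by
    simpa using Matrix.dotProduct_star_self_pos_iff.mpr hx
  have hnn : 0 ≤ x ⬝ᵥ A.mulVec x := ge_of_tendsto (hquad x)
    (hpd.mono fun i hi => by simpa using hi.posSemidef.dotProduct_mulVec_nonneg x)
  refine lt_of_le_of_ne (by simpa using hnn) fun h0 => ?_
  have h0' : x ⬝ᵥ A.mulVec x = 0 := by simpa using h0.symm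
  have h := hkey x ((|M| + 1) / (x ⬝ᵥ x))
  rw [h0', mul_zero, sub_zero, div_mul_cancel₀ _ hxx.ne'] at h
  have := le_abs_self M
  have := abs_nonneg M
  linarith

theorem nonneg_of_forall_add_mul_nonneg {a b : ℝ}
    (h : ∀ s : ℝ, 0 < s → s ≤ 1 → 0 ≤ a + s * b) : 0 ≤ a := by
  have ht : Tendsto (fun s : ℝ => a + s * b) (𝓝[>] 0) (𝓝 (a + 0 * b)) :=
    ((continuous_const.add (continuous_id.mul continuous_const)).tendsto 0).mono_left
      nhdsWithin_le_nhds
  rw [zero_mul, add_zero] at ht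
  refine ge_of_tendsto ht ?_
  filter_upwards [Ioc_mem_nhdsGT (zero_lt_one' ℝ)] with s hs
  exact h s hs.1 hs.2

theorem convex_setOf_posDef (T : ℕ) : Convex ℝ {A : Matrix (Fin T) (Fin T) ℝ | A.PosDef} := by
  intro A hA B hB a b ha hb hab
  rcases ha.eq_or_lt with rfl | ha
  · obtain rfl : b = 1 := by linarith
    simpa using hB
  · exact (Matrix.PosDef.smul hA ha).add_posSemidef (Matrix.PosSemidef.smul hB.posSemidef hb)

/-- By homogeneity only the unit sphere matters, and it is compact. Symmetry is not required here,
since symmetric matrices are in general not open among all matrices. -/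
theorem isOpen_setOf_forall_dotProduct_mulVec_pos (T : ℕ) :
    IsOpen {B : Matrix (Fin T) (Fin T) ℝ | ∀ x : Fin T → ℝ, x ≠ 0 → 0 < x ⬝ᵥ B.mulVec x} := by
  rw [isOpen_iff_mem_nhds]
  intro B₀ hB₀
  have hcont : Continuous fun p : Matrix (Fin T) (Fin T) ℝ × (Fin T → ℝ) =>
      p.2 ⬝ᵥ p.1.mulVec p.2 :=
    continuous_snd.dotProduct (continuous_fst.matrix_mulVec continuous_snd)
  have hev : ∀ᶠ B in 𝓝 B₀, ∀ x ∈ Metric.sphere (0 : Fin T → ℝ) 1, 0 < x ⬝ᵥ B.mulVec x := by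
    refine (isCompact_sphere _ _).eventually_forall_of_forall_eventually fun x hx => ?_
    have hx0 : x ≠ 0 := by
      rintro rfl
      simp at hx
    exact hcont.continuousAt.eventually (lt_mem_nhds (hB₀ x hx0))
  filter_upwards [hev] with B hB x hx
  have hnx : 0 < ‖x‖ := norm_pos_iff.mpr hx
  have h := hB (‖x‖⁻¹ • x) (by simp [norm_smul, hnx.ne'])
  rw [Matrix.mulVec_smul, smul_dotProduct, dotProduct_smul, smul_smul, smul_eq_mul] at h
  exact pos_of_mul_pos_right h (by positivity)

/-- A convex function on the positive semidefinite cone is continuous along sequences of positive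
definite matrices with positive definite limit. -/
theorem ConvexOn.tendsto_of_posDef {T : ℕ} {F : Matrix (Fin T) (Fin T) ℝ → ℝ}
    (hF : ConvexOn ℝ (psdCone T) F) {ι : Type*} {l : Filter ι}
    {a : ι → Matrix (Fin T) (Fin T) ℝ} {A : Matrix (Fin T) (Fin T) ℝ} (hA : A.PosDef)
    (hpd : ∀ᶠ i in l, (a i).PosDef) (ha : Tendsto a l (𝓝 A)) :
    Tendsto (fun i => F (a i)) l (𝓝 (F A)) := by
  let _ : NormedAddCommGroup (Matrix (Fin T) (Fin T) ℝ) := Matrix.normedAddCommGroup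
  let _ : NormedSpace ℝ (Matrix (Fin T) (Fin T) ℝ) := Matrix.normedSpace
  -- Precomposing `F` with symmetrization gives a convex function on an open set of all matrices,
  -- where finite-dimensional convexity yields continuity; `σ` fixes positive definite matrices.
  let σ : Matrix (Fin T) (Fin T) ℝ →ₗ[ℝ] Matrix (Fin T) (Fin T) ℝ :=
    (1 / 2 : ℝ) • (LinearMap.id + (Matrix.transposeLinearEquiv (Fin T) (Fin T) ℝ ℝ).toLinearMap)
  have hσ : ∀ B, σ B = (1 / 2 : ℝ) • (B + B.transpose) := fun B => rfl
  have hfix : ∀ B : Matrix (Fin T) (Fin T) ℝ, B.PosDef → σ B = B := by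
    intro B hB
    have ht : B.transpose = B := by simpa using hB.isHermitian.eq
    rw [hσ, ht, ← two_smul ℝ B, smul_smul]
    norm_num
  have hσq : ∀ (B : Matrix (Fin T) (Fin T) ℝ) (x : Fin T → ℝ),
      x ⬝ᵥ (σ B).mulVec x = x ⬝ᵥ B.mulVec x := by
    intro B x
    have : x ⬝ᵥ B.transpose.mulVec x = x ⬝ᵥ B.mulVec x := by
      rw [Matrix.mulVec_transpose, Matrix.dotProduct_mulVec, dotProduct_comm]
    rw [hσ, Matrix.smul_mulVec, Matrix.add_mulVec, dotProduct_smul, dotProduct_add, this,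
      smul_eq_mul]
    ring
  have hpre : σ ⁻¹' {B | B.PosDef}
      = {B : Matrix (Fin T) (Fin T) ℝ | ∀ x : Fin T → ℝ, x ≠ 0 → 0 < x ⬝ᵥ B.mulVec x} := by
    ext B
    constructor
    · intro hB x hx
      rw [← hσq]
      simpa using Matrix.PosDef.dotProduct_mulVec_pos hB hx
    · intro hB
      refine Matrix.PosDef.of_dotProduct_mulVec_pos ?_ fun x hx => ?_
      · simp [hσ, Matrix.IsHermitian, add_comm]
      · simpa [hσq] using hB x hx
  have hopen : IsOpen (σ ⁻¹' {B | B.PosDef}) :=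
    hpre ▸ isOpen_setOf_forall_dotProduct_mulVec_pos T
  have hconv : ConvexOn ℝ (σ ⁻¹' {B | B.PosDef}) (F ∘ σ) :=
    (hF.subset (fun B hB => Matrix.PosDef.posSemidef hB) (convex_setOf_posDef T)).comp_linearMap σ
  have hmem : A ∈ σ ⁻¹' {B | B.PosDef} := by simpa [hfix A hA] using hA
  have hcont : ContinuousAt (F ∘ σ) A := (hconv.continuousOn hopen).continuousAt (hopen.mem_nhds hmem)
  have h := hcont.tendsto.comp ha
  simp only [Function.comp_apply, hfix A hA] at h
  refine h.congr' (hpd.mono fun i hi => ?_)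
  simp [hfix _ hi]

/-! ### From blockwise to global minimality -/

/-- The value of `perturbedObjective` on positive definite matrices, as a real number. -/
noncomputable def finiteObjective {n T : ℕ}
    (V : Matrix (Fin n) (Fin T) ℝ → Matrix (Fin n) (Fin T) ℝ → ℝ)
    (F : Matrix (Fin T) (Fin T) ℝ → ℝ)
    (K : Matrix (Fin n) (Fin n) ℝ) (Y : Matrix (Fin n) (Fin T) ℝ) (lam δ : ℝ)
    (C : Matrix (Fin n) (Fin T) ℝ) (A : Matrix (Fin T) (Fin T) ℝ) : ℝ :=
  V Y (K * C) + lam * traceBarrier K δ C A + F A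

section objective

variable {n T : ℕ} {V : Matrix (Fin n) (Fin T) ℝ → Matrix (Fin n) (Fin T) ℝ → ℝ}
  {F : Matrix (Fin T) (Fin T) ℝ → ℝ} {K : Matrix (Fin n) (Fin n) ℝ}
  {Y : Matrix (Fin n) (Fin T) ℝ} {lam δ : ℝ}

theorem perturbedObjective_of_posDef {A : Matrix (Fin T) (Fin T) ℝ} (hA : A.PosDef)
    (C : Matrix (Fin n) (Fin T) ℝ) :
    perturbedObjective V F K Y lam δ C A = (finiteObjective V F K Y lam δ C A : EReal) := by
  simp only [perturbedObjective, if_pos hA, finiteObjective, traceBarrier]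

theorem perturbedObjective_of_not_posDef {A : Matrix (Fin T) (Fin T) ℝ} (hA : ¬ A.PosDef)
    (C : Matrix (Fin n) (Fin T) ℝ) : perturbedObjective V F K Y lam δ C A = ⊤ := by
  simp only [perturbedObjective, if_neg hA]

theorem perturbedObjective_lt_top_iff {A : Matrix (Fin T) (Fin T) ℝ}
    {C : Matrix (Fin n) (Fin T) ℝ} : perturbedObjective V F K Y lam δ C A < ⊤ ↔ A.PosDef := by
  by_cases hA : A.PosDef
  · simp [perturbedObjective_of_posDef hA, hA]
  · simp [perturbedObjective_of_not_posDef hA, hA]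

/-- A positive definite block-coordinatewise minimizer is a global minimizer. -/
theorem finiteObjective_le_of_blockwise (hV : ConvexOn ℝ Set.univ (V Y))
    (hF : ConvexOn ℝ (psdCone T) F) (hK : K.PosSemidef) (hlam : 0 < lam)
    {C₀ : Matrix (Fin n) (Fin T) ℝ} {A₀ : Matrix (Fin T) (Fin T) ℝ} (hA₀ : A₀.PosDef)
    (hminC : ∀ C, finiteObjective V F K Y lam δ C₀ A₀ ≤ finiteObjective V F K Y lam δ C A₀)
    (hminA : ∀ A : Matrix (Fin T) (Fin T) ℝ, A.PosDef →
      finiteObjective V F K Y lam δ C₀ A₀ ≤ finiteObjective V F K Y lam δ C₀ A)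
    (C : Matrix (Fin n) (Fin T) ℝ) {A : Matrix (Fin T) (Fin T) ℝ} (hA : A.PosDef) :
    finiteObjective V F K Y lam δ C₀ A₀ ≤ finiteObjective V F K Y lam δ C A := by
  set M := C₀.transpose * K * C₀ + δ ^ 2 • (1 : Matrix (Fin T) (Fin T) ℝ) with hM
  -- First-order condition in `C`: the smooth barrier contributes its derivative, while `V`,
  -- possibly nonsmooth, contributes a full increment by convexity.
  have hCdir : 0 ≤ V Y (K * C) - V Y (K * C₀)
      + lam * (2 * (A₀⁻¹ * (C₀.transpose * K * (C - C₀))).trace) := by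
    refine nonneg_of_forall_add_mul_nonneg
      (b := lam * (A₀⁻¹ * ((C - C₀).transpose * K * (C - C₀))).trace) fun s hs hs1 => ?_
    have h := hminC (C₀ + s • (C - C₀))
    simp only [finiteObjective, traceBarrier_add_smul hK hA₀] at h
    have hv := hV.2 (Set.mem_univ (K * C₀)) (Set.mem_univ (K * C)) (sub_nonneg.mpr hs1) hs.le
      (by ring)
    have e : (1 - s) • (K * C₀) + s • (K * C) = K * (C₀ + s • (C - C₀)) := by
      rw [Matrix.mul_add, Matrix.mul_smul, Matrix.mul_sub]
      module
    rw [e] at hv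
    simp only [smul_eq_mul] at hv
    refine nonneg_of_mul_nonneg_right (a := s) ?_ hs
    linarith
  have hAdir : 0 ≤ F A - F A₀ - lam * (A₀⁻¹ * M * A₀⁻¹ * (A - A₀)).trace := by
    have hline : Tendsto (fun s : ℝ => A₀ + s • (A - A₀)) (𝓝[>] 0) (𝓝 A₀) := by
      have hc : Continuous fun s : ℝ => A₀ + s • (A - A₀) := by fun_prop
      simpa using (hc.tendsto 0).mono_left nhdsWithin_le_nhds
    have hinv : Tendsto (fun s : ℝ => (A₀ + s • (A - A₀))⁻¹) (𝓝[>] 0) (𝓝 A₀⁻¹) :=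
      hA₀.continuousAt_inv.tendsto.comp hline
    have htr : Continuous fun B : Matrix (Fin T) (Fin T) ℝ => B.trace := continuous_id.matrix_trace
    have hlim := ((((htr.tendsto _).comp
      (((hinv.mul_const M).mul hinv).mul_const (A - A₀))).const_mul lam).const_sub (F A - F A₀))
    refine ge_of_tendsto hlim ?_
    filter_upwards [Ioc_mem_nhdsGT (zero_lt_one' ℝ)] with s hs
    have hcomb : A₀ + s • (A - A₀) = (1 - s) • A₀ + s • A := by module
    have hpd : (A₀ + s • (A - A₀)).PosDef := by
      rw [hcomb]
      exact convex_setOf_posDef T hA₀ hA (sub_nonneg.mpr hs.2) hs.1.le (by ring)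
    -- The tangent is taken at the moving point `A₀ + s • (A - A₀)` and evaluated at `A₀`. After
    -- division by `s`, continuity of the inverse gives the condition at `A₀`.
    have h1 := hminA _ hpd
    have h2 := traceBarrier_tangent (δ := δ) hK hA₀ hpd C₀ C₀
    have h3 := hF.2 (show A₀ ∈ psdCone T from hA₀.posSemidef) (show A ∈ psdCone T from hA.posSemidef)
      (sub_nonneg.mpr hs.2) hs.1.le (by ring)
    rw [← hcomb] at h3
    have e : A₀ - (A₀ + s • (A - A₀)) = (-s) • (A - A₀) := by module
    rw [e, Matrix.mul_smul, Matrix.trace_smul, sub_self, Matrix.mul_zero, Matrix.mul_zero,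
      Matrix.trace_zero, ← hM, smul_eq_mul] at h2
    simp only [finiteObjective, smul_eq_mul] at h1 h3
    have h4 := mul_le_mul_of_nonneg_left h2 hlam.le
    simp only [Function.comp_apply]
    refine nonneg_of_mul_nonneg_right (a := s) ?_ hs.1
    linarith
  have h := mul_le_mul_of_nonneg_left (traceBarrier_tangent (δ := δ) hK hA hA₀ C C₀) hlam.le
  rw [← hM] at h
  simp only [finiteObjective]
  linarith

end objective

/-! ### First-order steps as approximate block minimization -/

/-- The segment from `x` to `y` stays in `U`, so a derivative relative to `U` controls the
difference quotients even if `U` has empty interior. -/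
theorem ConvexOn.add_fderivWithin_le {E : Type*} [AddCommGroup E] [Module ℝ E] [TopologicalSpace E]
    [ContinuousAdd E] [ContinuousSMul ℝ E]
    {U : Set E} {g : E → ℝ} {g' : E →L[ℝ] ℝ} {x y : E} (hg : ConvexOn ℝ U g)
    (hx : x ∈ U) (hy : y ∈ U) (hd : HasFDerivWithinAt g g' U x) :
    g x + g' (y - x) ≤ g y := by
  have hcomb : ∀ s : ℝ, x + s • (y - x) = (1 - s) • x + s • y := fun s => by module
  have hs : ∀ᶠ s : ℝ in 𝓝[>] 0, s ∈ Set.Ioc (0 : ℝ) 1 := Ioc_mem_nhdsGT (zero_lt_one' ℝ)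
  have hlim := hd.lim (l := 𝓝[>] (0 : ℝ)) (c := fun s => s⁻¹) (d := fun s => s • (y - x))
    (v := y - x) ?_ ?_ ?_
  · have : g' (y - x) ≤ g y - g x := by
      refine le_of_tendsto hlim ?_
      filter_upwards [hs] with s hs
      have h := hg.2 hx hy (sub_nonneg.mpr hs.2) hs.1.le (by ring)
      rw [← hcomb] at h
      simp only [smul_eq_mul] at h ⊢
      rw [inv_mul_le_iff₀ hs.1]
      linarith
    linarith
  · have hc : Continuous fun s : ℝ => s • (y - x) := continuous_id.smul continuous_const
    simpa using (hc.tendsto 0).mono_left nhdsWithin_le_nhds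
  · filter_upwards [hs] with s hs
    rw [hcomb]
    exact hg.1 hx hy (sub_nonneg.mpr hs.2) hs.1.le (by ring)
  · refine tendsto_const_nhds.congr' ?_
    filter_upwards [hs] with s hs
    rw [smul_smul, inv_mul_cancel₀ hs.1.ne', one_smul]

section frob

variable {p q : ℕ}

theorem frobSq_nonneg (M : Matrix (Fin p) (Fin q) ℝ) : 0 ≤ frobSq M :=
  Finset.sum_nonneg fun _ _ => Finset.sum_nonneg fun _ _ => sq_nonneg _

theorem continuous_frobSq : Continuous (frobSq : Matrix (Fin p) (Fin q) ℝ → ℝ) := by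
  unfold frobSq
  fun_prop

theorem frobSq_add_smul_sub (x y z : Matrix (Fin p) (Fin q) ℝ) (s : ℝ) :
    frobSq (z + s • (y - z) - x)
      = (1 - s) * frobSq (z - x) + s * frobSq (y - x) - s * (1 - s) * frobSq (y - z) := by
  simp only [frobSq, Finset.mul_sum, ← Finset.sum_add_distrib, ← Finset.sum_sub_distrib]
  refine Finset.sum_congr rfl fun i _ => Finset.sum_congr rfl fun j _ => ?_
  simp only [Matrix.sub_apply, Matrix.add_apply, Matrix.smul_apply, smul_eq_mul]
  ring

/-- Young's inequality for `‖y - x‖² - ‖y - z‖² = 2⟪y - x, z - x⟫ - ‖z - x‖²`. -/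
theorem frobSq_sub_frobSq_le (x y z : Matrix (Fin p) (Fin q) ℝ) {ε : ℝ} (hε : 0 < ε) :
    frobSq (y - x) - frobSq (y - z) ≤ ε * frobSq (y - x) + frobSq (z - x) / ε := by
  simp only [frobSq, Finset.mul_sum, Finset.sum_div, ← Finset.sum_add_distrib,
    ← Finset.sum_sub_distrib]
  refine Finset.sum_le_sum fun i _ => Finset.sum_le_sum fun j _ => ?_
  simp only [Matrix.sub_apply]
  have h : 0 ≤ (ε * (y i j - x i j) - (z i j - x i j)) ^ 2 / ε := by positivity
  have e : (ε * (y i j - x i j) - (z i j - x i j)) ^ 2 / ε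
      = ε * (y i j - x i j) ^ 2 - 2 * ((y i j - x i j) * (z i j - x i j))
        + (z i j - x i j) ^ 2 / ε := by
    field_simp
    ring
  nlinarith [sq_nonneg (z i j - x i j)]

/-- The point `x'` decreases the function `φ`, and it minimizes `φ` over `U` up to an error that is
controlled by the decrease `φ x - φ x'`. -/
def IsDescentStep (κ : ℝ) (φ : Matrix (Fin p) (Fin q) ℝ → ℝ) (U : Set (Matrix (Fin p) (Fin q) ℝ))
    (x x' : Matrix (Fin p) (Fin q) ℝ) : Prop :=
  φ x' ≤ φ x ∧ ∀ y ∈ U, ∀ ε > 0, φ x' ≤ φ y + ε * κ * frobSq (y - x) + (φ x - φ x') / ε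

theorem IsDescentStep.of_forall_le {φ : Matrix (Fin p) (Fin q) ℝ → ℝ}
    {U : Set (Matrix (Fin p) (Fin q) ℝ)} {x x' : Matrix (Fin p) (Fin q) ℝ} (hx : x ∈ U)
    (h : ∀ y ∈ U, φ x' ≤ φ y) : IsDescentStep 1 φ U x x' := by
  refine ⟨h x hx, fun y hy ε hε => ?_⟩
  have h1 := h y hy
  have h2 : 0 ≤ ε * 1 * frobSq (y - x) := mul_nonneg (by linarith) (frobSq_nonneg _)
  have h3 : 0 ≤ (φ x - φ x') / ε := div_nonneg (sub_nonneg.mpr (h x hx)) hε.le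
  linarith

/-- The proximal point of a convex function satisfies the three-point inequality. -/
theorem ConvexOn.three_point_le {D : Set (Matrix (Fin p) (Fin q) ℝ)}
    {h : Matrix (Fin p) (Fin q) ℝ → ℝ} (hh : ConvexOn ℝ D h) {ℓ : Matrix (Fin p) (Fin q) ℝ →L[ℝ] ℝ}
    {γ : ℝ} {x x' : Matrix (Fin p) (Fin q) ℝ} (hx' : x' ∈ D)
    (hmin : ∀ y ∈ D, h x' + ℓ (x' - x) + frobSq (x' - x) / (2 * γ)
      ≤ h y + ℓ (y - x) + frobSq (y - x) / (2 * γ))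
    {y : Matrix (Fin p) (Fin q) ℝ} (hy : y ∈ D) :
    h x' + ℓ (x' - x) + frobSq (x' - x) / (2 * γ) + frobSq (y - x') / (2 * γ)
      ≤ h y + ℓ (y - x) + frobSq (y - x) / (2 * γ) := by
  have key : 0 ≤ (h y + ℓ (y - x) + frobSq (y - x) / (2 * γ)
      - (h x' + ℓ (x' - x) + frobSq (x' - x) / (2 * γ)) - frobSq (y - x') / (2 * γ)) := by
    -- Moving `x'` a fraction `s` towards `y` and dividing by `s` leaves an error `s * frobSq (y -
    -- x') / (2 * γ)`, which vanishes as `s → 0`.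
    refine nonneg_of_forall_add_mul_nonneg (b := frobSq (y - x') / (2 * γ)) fun s hs hs1 => ?_
    have hcomb : x' + s • (y - x') = (1 - s) • x' + s • y := by module
    have hmem : x' + s • (y - x') ∈ D := by
      rw [hcomb]
      exact hh.1 hx' hy (sub_nonneg.mpr hs1) hs.le (by ring)
    have h1 := hmin _ hmem
    have h2 := hh.2 hx' hy (sub_nonneg.mpr hs1) hs.le (by ring)
    rw [← hcomb] at h2
    have h3 : ℓ (x' + s • (y - x') - x) = (1 - s) * ℓ (x' - x) + s * ℓ (y - x) := by
      have : x' + s • (y - x') - x = (1 - s) • (x' - x) + s • (y - x) := by module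
      rw [this]
      simp
    rw [h3, frobSq_add_smul_sub] at h1
    simp only [smul_eq_mul] at h2
    refine nonneg_of_mul_nonneg_right (a := s) ?_ hs
    have e : ((1 - s) * frobSq (x' - x) + s * frobSq (y - x) - s * (1 - s) * frobSq (y - x'))
          / (2 * γ)
        = (1 - s) * (frobSq (x' - x) / (2 * γ)) + s * (frobSq (y - x) / (2 * γ))
          - s * (1 - s) * (frobSq (y - x') / (2 * γ)) := by ring
    rw [e] at h1
    linarith
  linarith

/-- The three-point inequality for `h`, the gradient inequality for `g` and admissibility add up to
`hmain`. Its case `y = x` bounds `frobSq (x' - x) / (2 * γ)` by the decrease, and Young's inequality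
does the rest. Only a lower bound on `γ` is needed. -/
theorem IsFirstOrderStep.isDescentStep {γmin : ℝ} (hγmin : 0 < γmin)
    {f : Matrix (Fin p) (Fin q) ℝ → EReal} {X : Set (Matrix (Fin p) (Fin q) ℝ)}
    {x x' : Matrix (Fin p) (Fin q) ℝ} (hstep : IsFirstOrderStep γmin f X x x')
    {φ : Matrix (Fin p) (Fin q) ℝ → ℝ} (hφ : ∀ y ∈ X, f y < ⊤ → f y = (φ y : EReal)) :
    IsDescentStep (1 / (2 * γmin)) φ {y | y ∈ X ∧ f y < ⊤} x x' := by
  obtain ⟨γ, U, D, g, h, g', hγ, rfl, hUD, -, hg, hh, hgh, hx, hd, hx', hmin, hadm⟩ := hstep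
  have hγ0 : 0 < γ := hγmin.trans_le hγ
  have hval : ∀ y ∈ {y | y ∈ X ∧ f y < ⊤}, φ y = g y + h y := fun y hy =>
    EReal.coe_injective ((hφ y hy.1 hy.2).symm.trans (hgh y hy))
  have hmain : ∀ y ∈ {y | y ∈ X ∧ f y < ⊤},
      φ x' ≤ φ y + (frobSq (y - x) - frobSq (y - x')) / (2 * γ) := by
    intro y hy
    have h1 := hh.three_point_le (hUD hx') hmin (hUD hy)
    have h2 := hg.add_fderivWithin_le hx hy hd
    rw [hval x' hx', hval y hy, sub_div]
    linarith
  have hdec : frobSq (x' - x) / (2 * γ) ≤ φ x - φ x' := by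
    have h1 := hmain x hx
    have e1 : frobSq (x - x) = 0 := by simp [frobSq]
    have e2 : frobSq (x - x') = frobSq (x' - x) := by
      simp only [frobSq, Matrix.sub_apply]
      exact Finset.sum_congr rfl fun i _ => Finset.sum_congr rfl fun j _ => by ring
    rw [e1, e2, zero_sub, neg_div] at h1
    linarith
  have hnn : 0 ≤ frobSq (x' - x) / (2 * γ) := div_nonneg (frobSq_nonneg _) (by linarith)
  refine ⟨by linarith, fun y hy ε hε => ?_⟩
  have h1 : (frobSq (y - x) - frobSq (y - x')) / (2 * γ)
      ≤ (ε * frobSq (y - x) + frobSq (x' - x) / ε) / (2 * γ) :=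
    div_le_div_of_nonneg_right (frobSq_sub_frobSq_le x y x' hε) (by linarith)
  have h2 : ε * frobSq (y - x) * (1 / (2 * γ)) ≤ ε * frobSq (y - x) * (1 / (2 * γmin)) :=
    mul_le_mul_of_nonneg_left (one_div_le_one_div_of_le (by linarith) (by linarith))
      (mul_nonneg hε.le (frobSq_nonneg _))
  have h3 : frobSq (x' - x) / (2 * γ) / ε ≤ (φ x - φ x') / ε :=
    div_le_div_of_nonneg_right hdec hε.le
  have e : (ε * frobSq (y - x) + frobSq (x' - x) / ε) / (2 * γ)
      = ε * frobSq (y - x) * (1 / (2 * γ)) + frobSq (x' - x) / (2 * γ) / ε := by ring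
  have := hmain y hy
  linarith

end frob

/-! ### Limit points of two-block descent -/

theorem CoerciveOnPSD.exists_isCompact {T : ℕ} {F : Matrix (Fin T) (Fin T) ℝ → ℝ}
    (hF : CoerciveOnPSD F) (M : ℝ) :
    ∃ Q : Set (Matrix (Fin T) (Fin T) ℝ), IsCompact Q ∧ ∀ A ∈ psdCone T, F A ≤ M → A ∈ Q := by
  have h := hF.eventually (eventually_gt_atTop M)
  rw [eventually_inf_principal] at h
  obtain ⟨Q, hQ, hQs⟩ := mem_cocompact.mp h
  exact ⟨Q, hQ, fun A hA hM => by_contra fun hn => (hQs hn hA).not_ge hM⟩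

theorem ConvexOn.continuous_matrix {p q : ℕ} {v : Matrix (Fin p) (Fin q) ℝ → ℝ}
    (hv : ConvexOn ℝ Set.univ v) : Continuous v := by
  let _ : NormedAddCommGroup (Matrix (Fin p) (Fin q) ℝ) := Matrix.normedAddCommGroup
  let _ : NormedSpace ℝ (Matrix (Fin p) (Fin q) ℝ) := Matrix.normedSpace
  exact continuousOn_univ.mp (hv.continuousOn isOpen_univ)

theorem MapClusterPt.comp_add_nat {E : Type*} [TopologicalSpace E] {u : ℕ → E} {P : E}
    (h : MapClusterPt P atTop u) (k : ℕ) : MapClusterPt P atTop fun t => u (t + k) := by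
  have e : map (fun t => u (t + k)) atTop = map u atTop := by
    conv_rhs => rw [← map_add_atTop_eq_nat k, map_map]
    rfl
  rw [MapClusterPt, e]
  exact h

section convergence

variable {n T : ℕ} {V : Matrix (Fin n) (Fin T) ℝ → Matrix (Fin n) (Fin T) ℝ → ℝ}
  {F : Matrix (Fin T) (Fin T) ℝ → ℝ} {K : Matrix (Fin n) (Fin n) ℝ}
  {Y : Matrix (Fin n) (Fin T) ℝ} {lam δ : ℝ}

theorem tendsto_finiteObjective (hV : ConvexOn ℝ Set.univ (V Y)) (hF : ConvexOn ℝ (psdCone T) F)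
    {ι : Type*} {l : Filter ι} {c : ι → Matrix (Fin n) (Fin T) ℝ}
    {a : ι → Matrix (Fin T) (Fin T) ℝ} {C : Matrix (Fin n) (Fin T) ℝ}
    {A : Matrix (Fin T) (Fin T) ℝ} (hA : A.PosDef) (hpd : ∀ᶠ i in l, (a i).PosDef)
    (hc : Tendsto c l (𝓝 C)) (ha : Tendsto a l (𝓝 A)) :
    Tendsto (fun i => finiteObjective V F K Y lam δ (c i) (a i)) l
      (𝓝 (finiteObjective V F K Y lam δ C A)) := by
  have hKc : Continuous fun B : Matrix (Fin n) (Fin T) ℝ => V Y (K * B) :=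
    hV.continuous_matrix.comp (continuous_const.matrix_mul continuous_id)
  exact (((hKc.tendsto C).comp hc).add ((tendsto_traceBarrier hA hc ha).const_mul lam)).add
    (hF.tendsto_of_posDef hA hpd ha)

/-- Limit points of two-block descent schemes are global minimizers. -/
theorem isMinimizer_of_isDescentStep (hV_nonneg : ∀ Z, 0 ≤ V Y Z)
    (hV : ConvexOn ℝ Set.univ (V Y)) (hF_nonneg : ∀ A ∈ psdCone T, 0 ≤ F A)
    (hF : ConvexOn ℝ (psdCone T) F) (hF_coercive : CoerciveOnPSD F)
    (hK : K.PosSemidef) (hlam : 0 < lam) (hδ : 0 < δ) {κ : ℝ}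
    {c : ℕ → Matrix (Fin n) (Fin T) ℝ} {a : ℕ → Matrix (Fin T) (Fin T) ℝ}
    (hpd : ∀ t, (a t).PosDef)
    (hstepC : ∀ t, IsDescentStep κ (fun C => finiteObjective V F K Y lam δ C (a t)) Set.univ
      (c t) (c (t + 1)))
    (hstepA : ∀ t, IsDescentStep κ (fun A => finiteObjective V F K Y lam δ (c (t + 1)) A)
      {A | A.PosDef} (a t) (a (t + 1)))
    {P : Matrix (Fin n) (Fin T) ℝ × Matrix (Fin T) (Fin T) ℝ}
    (hP : MapClusterPt P atTop fun t => (c (t + 1), a (t + 1))) :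
    IsMinimizer (fun Q => perturbedObjective V F K Y lam δ Q.1 Q.2) (Set.univ ×ˢ psdCone T) P := by
  obtain ⟨C, A⟩ := P
  obtain ⟨u, hu, htend⟩ := mapClusterPt_iff_ultrafilter.mp hP
  have hc : Tendsto (fun t => c (t + 1)) u (𝓝 C) := (continuous_fst.tendsto _).comp htend
  have ha : Tendsto (fun t => a (t + 1)) u (𝓝 A) := (continuous_snd.tendsto _).comp htend
  set s := finiteObjective V F K Y lam δ with hs
  have hterms : ∀ t, F (a t) ≤ s (c t) (a t) ∧ lam * traceBarrier K δ (c t) (a t) ≤ s (c t) (a t)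
      ∧ 0 ≤ s (c t) (a t) := by
    intro t
    have h1 := hV_nonneg (K * c t)
    have h2 := hF_nonneg (a t) (hpd t).posSemidef
    have h3 := mul_nonneg hlam.le (traceBarrier_nonneg (δ := δ) hK (hpd t) (c t))
    simp only [hs, finiteObjective]
    exact ⟨by linarith, by linarith, by linarith⟩
  have hdescC : ∀ t, s (c (t + 1)) (a t) ≤ s (c t) (a t) := fun t => (hstepC t).1
  have hdescA : ∀ t, s (c (t + 1)) (a (t + 1)) ≤ s (c (t + 1)) (a t) := fun t => (hstepA t).1
  have hanti : Antitone fun t => s (c t) (a t) :=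
    antitone_nat_of_succ_le fun t => (hdescA t).trans (hdescC t)
  have hbound : ∀ t, s (c t) (a t) ≤ s (c 0) (a 0) := fun t => hanti (Nat.zero_le t)
  have hconv := tendsto_atTop_ciInf hanti ⟨0, by rintro _ ⟨t, rfl⟩; exact (hterms t).2.2⟩
  set d : ℕ → ℝ := fun t => s (c t) (a t) - s (c (t + 1)) (a (t + 1)) with hd
  have hd0 : Tendsto d atTop (𝓝 0) := by
    simpa using hconv.sub (hconv.comp (tendsto_add_atTop_nat 1))
  have hdu : Tendsto d u (𝓝 0) := hd0.mono_left hu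
  have hdu1 : Tendsto (fun t => d (t + 1)) u (𝓝 0) :=
    (hd0.comp (tendsto_add_atTop_nat 1)).mono_left hu
  have hA : A.PosDef := by
    refine Matrix.PosDef.of_tendsto_of_trace_inv_le (M := s (c 0) (a 0) / (lam * δ ^ 2)) ha
      (Eventually.of_forall fun t => hpd _) (Eventually.of_forall fun t => ?_)
    rw [le_div_iff₀ (by positivity)]
    have h1 := mul_le_mul_of_nonneg_left
      (sq_mul_trace_inv_le_traceBarrier (δ := δ) hK (hpd (t + 1)) (c (t + 1))) hlam.le
    have h2 := (hterms (t + 1)).2.1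
    have h3 := hbound (t + 1)
    linarith
  have hlimit : Tendsto (fun t => s (c (t + 1)) (a (t + 1))) u (𝓝 (s C A)) :=
    tendsto_finiteObjective hV hF hA (Eventually.of_forall fun t => hpd _) hc ha
  have hminC : ∀ C', s C A ≤ s C' A := by
    intro C'
    have h : ∀ ε > 0, s C A ≤ s C' A + ε * κ * frobSq (C' - C) := by
      intro ε hε
      have hR : Tendsto (fun t => s C' (a (t + 1)) + ε * κ * frobSq (C' - c (t + 1))
          + (d (t + 1) + d (t + 1) / ε)) u
          (𝓝 (s C' A + ε * κ * frobSq (C' - C) + (0 + 0 / ε))) :=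
        ((tendsto_finiteObjective hV hF hA (Eventually.of_forall fun t => hpd _)
          tendsto_const_nhds ha).add
          (((continuous_frobSq.tendsto _).comp (hc.const_sub C')).const_mul (ε * κ))).add
          (hdu1.add (hdu1.div_const ε))
      rw [zero_div, add_zero, add_zero] at hR
      refine le_of_tendsto_of_tendsto hlimit hR (Eventually.of_forall fun t => ?_)
      -- This step starts at the convergent pair. Its output `c (t + 2)` need not converge, but its
      -- objective value differs from the current one by at most `d (t + 1)`.
      have h1 := (hstepC (t + 1)).2 C' (Set.mem_univ _) ε hε
      have h2 := hdescA (t + 1)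
      have h3 : (s (c (t + 1)) (a (t + 1)) - s (c (t + 1 + 1)) (a (t + 1))) / ε ≤ d (t + 1) / ε :=
        div_le_div_of_nonneg_right (by simp only [hd]; linarith) hε.le
      simp only [hd] at h3 ⊢
      simp only at h1
      linarith
    have hk : 0 ≤ s C' A - s C A := by
      refine nonneg_of_forall_add_mul_nonneg (b := κ * frobSq (C' - C)) fun ε hε _ => ?_
      have := h ε hε
      linarith
    linarith
  have hminA : ∀ A' : Matrix (Fin T) (Fin T) ℝ, A'.PosDef → s C A ≤ s C A' := by
    intro A' hA'
    -- The `A`-step producing `a (t + 1)` starts at `a t`, which need not converge along `u`.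
    -- Coercivity keeps all `a t` in a compact set, so the distance term is uniformly bounded.
    obtain ⟨Q, hQ, hQmem⟩ := hF_coercive.exists_isCompact (s (c 0) (a 0))
    obtain ⟨R, hR⟩ := hQ.bddAbove_image (f := fun B => κ * frobSq (A' - B))
      (continuous_const.mul (continuous_frobSq.comp (continuous_const.sub continuous_id))).continuousOn
    have haR : ∀ t, κ * frobSq (A' - a t) ≤ R := fun t =>
      hR ⟨a t, hQmem _ (hpd t).posSemidef ((hterms t).1.trans (hbound t)), rfl⟩
    have h : ∀ ε > 0, s C A ≤ s C A' + ε * R := by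
      intro ε hε
      have hR : Tendsto (fun t => s (c (t + 1)) A' + ε * R + d t / ε) u
          (𝓝 (s C A' + ε * R + 0 / ε)) :=
        ((tendsto_finiteObjective hV hF hA' (Eventually.of_forall fun _ => hA')
          hc tendsto_const_nhds).add_const _).add (hdu.div_const ε)
      rw [zero_div, add_zero] at hR
      refine le_of_tendsto_of_tendsto hlimit hR (Eventually.of_forall fun t => ?_)
      have h1 := (hstepA t).2 A' hA' ε hε
      have h2 := hdescC t
      have h3 : (s (c (t + 1)) (a t) - s (c (t + 1)) (a (t + 1))) / ε ≤ d t / ε :=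
        div_le_div_of_nonneg_right (by simp only [hd]; linarith) hε.le
      have h4 := mul_le_mul_of_nonneg_left (haR t) hε.le
      simp only at h1
      linarith
    have hk : 0 ≤ s C A' - s C A := by
      refine nonneg_of_forall_add_mul_nonneg (b := R) fun ε hε _ => ?_
      have := h ε hε
      linarith
    linarith
  refine ⟨⟨Set.mem_univ _, hA.posSemidef⟩, ?_⟩
  rintro ⟨C', A'⟩ -
  by_cases hA' : A'.PosDef
  · simp only [perturbedObjective_of_posDef hA, perturbedObjective_of_posDef hA']
    exact EReal.coe_le_coe_iff.mpr
      (finiteObjective_le_of_blockwise hV hF hK hlam hA hminC hminA C' hA')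
  · simp only [perturbedObjective_of_not_posDef hA', le_top]

end convergence

/-! ### The two algorithms -/

theorem mainTheorem3 {n T : ℕ}
    (V : Matrix (Fin n) (Fin T) ℝ → Matrix (Fin n) (Fin T) ℝ → ℝ)
    (F : Matrix (Fin T) (Fin T) ℝ → ℝ)
    (K : Matrix (Fin n) (Fin n) ℝ) (Y : Matrix (Fin n) (Fin T) ℝ) (lam δ : ℝ)
    (hV_nonneg : ∀ Z, 0 ≤ V Y Z) (hV_convex : ConvexOn ℝ Set.univ (V Y))
    (hF_nonneg : ∀ A ∈ psdCone T, 0 ≤ F A) (hF_convex : ConvexOn ℝ (psdCone T) F)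
    (hF_coercive : CoerciveOnPSD F)
    (hK : K.PosSemidef) (hlam : 0 < lam) (hδ : 0 < δ) :
    (∀ (C : ℕ → Matrix (Fin n) (Fin T) ℝ) (A : ℕ → Matrix (Fin T) (Fin T) ℝ),
      IsAlternatingMinimizationRun (perturbedObjective V F K Y lam δ) C A →
      ∀ P : Matrix (Fin n) (Fin T) ℝ × Matrix (Fin T) (Fin T) ℝ,
        MapClusterPt P atTop (fun t => (C t, A t)) →
        IsMinimizer (fun Q => perturbedObjective V F K Y lam δ Q.1 Q.2)
          (Set.univ ×ˢ psdCone T) P) ∧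
    (∀ (γmin : ℝ), 0 < γmin →
      ∀ (C : ℕ → Matrix (Fin n) (Fin T) ℝ) (A : ℕ → Matrix (Fin T) (Fin T) ℝ),
      IsBlockCoordinateDescentRun γmin (perturbedObjective V F K Y lam δ) C A →
      ∀ P : Matrix (Fin n) (Fin T) ℝ × Matrix (Fin T) (Fin T) ℝ,
        MapClusterPt P atTop (fun t => (C t, A t)) →
        IsMinimizer (fun Q => perturbedObjective V F K Y lam δ Q.1 Q.2)
          (Set.univ ×ˢ psdCone T) P) := by

  refine ⟨fun C A hrun P hP => ?_, fun γmin hγmin C A hrun P hP => ?_⟩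
  · have hpd : ∀ t, (A (t + 1)).PosDef := by
      intro t
      -- `A 0` may be singular, but a minimizer does at least as well as the identity, where the
      -- objective is finite. Hence the run is used from time 1.
      have h := (hrun.2 t).2.2 1 Matrix.PosSemidef.one
      exact perturbedObjective_lt_top_iff.mp
        (h.trans_lt (perturbedObjective_lt_top_iff.mpr Matrix.PosDef.one))
    refine isMinimizer_of_isDescentStep (κ := 1) (c := fun t => C (t + 1)) (a := fun t => A (t + 1))
      hV_nonneg hV_convex hF_nonneg hF_convex hF_coercive hK hlam hδ hpd (fun t => ?_) (fun t => ?_)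
      (hP.comp_add_nat 2)
    · refine IsDescentStep.of_forall_le (Set.mem_univ _) fun C' _ => ?_
      have h := (hrun.2 (t + 1)).1.2 C' (Set.mem_univ _)
      simpa only [perturbedObjective_of_posDef (hpd t), EReal.coe_le_coe_iff] using h
    · refine IsDescentStep.of_forall_le (hpd t) fun A' hA' => ?_
      have h := (hrun.2 (t + 1)).2.2 A' (Matrix.PosDef.posSemidef hA')
      simpa only [perturbedObjective_of_posDef (hpd (t + 1)), perturbedObjective_of_posDef hA',
        EReal.coe_le_coe_iff] using h
  · have hpd : ∀ t, (A t).PosDef := by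
      intro t
      -- A first-order step starts in the effective domain, so here even `A 0` is positive definite.
      obtain ⟨γ, U, D, g, h, g', -, rfl, -, -, -, -, -, hx, -⟩ := (hrun.2 t).2
      exact perturbedObjective_lt_top_iff.mp hx.2
    refine isMinimizer_of_isDescentStep (κ := 1 / (2 * γmin)) hV_nonneg hV_convex hF_nonneg
      hF_convex hF_coercive hK hlam hδ hpd (fun t => ?_) (fun t => ?_) (hP.comp_add_nat 1)
    · have h := (hrun.2 t).1.isDescentStep hγmin
        (φ := fun C' => finiteObjective V F K Y lam δ C' (A t))
        fun C' _ _ => perturbedObjective_of_posDef (hpd t) C'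
      exact ⟨h.1, fun y _ => h.2 y ⟨Set.mem_univ _, perturbedObjective_lt_top_iff.mpr (hpd t)⟩⟩
    · have h := (hrun.2 t).2.isDescentStep hγmin
        (φ := fun A' => finiteObjective V F K Y lam δ (C (t + 1)) A')
        fun A' _ hA' => perturbedObjective_of_posDef (perturbedObjective_lt_top_iff.mp hA') _
      exact ⟨h.1, fun y hy => h.2 y
        ⟨Matrix.PosDef.posSemidef hy, perturbedObjective_lt_top_iff.mpr hy⟩⟩
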